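/- The fork is the five-vertex tree obtained from a four-vertex path by adding a vertex adjacent to the second vertex of the path, and the antifork is its complement graph. A finite simple graph $G$ is uncluttered if no induced subgraph of $G$ is isomorphic to the fork or the antifork. For a finite simple graph $G$, let $\chi(G)$ denote its chromatic number and $\omega(G)$ the number of vertices in a largest clique of $G$. Theorem. Every uncluttered finite simple graph $G$ satisfies $\chi(G) \le 2\,\omega(G)$. -/

import Mathlib

/-- The fork: the four-vertex path `0 - 1 - 2 - 3` together with one more vertex `4`
adjacent to the second vertex `1` of the path (the claw with one edge subdivided once). -/
def forkGraph : SimpleGraph (Fin 5) :=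
  SimpleGraph.fromEdgeSet {s(0, 1), s(1, 2), s(2, 3), s(1, 4)}

/-- The antifork: the complement of the fork. -/
def antiforkGraph : SimpleGraph (Fin 5) := forkGraphᶜ

/-- A graph is uncluttered if none of its induced subgraphs is (isomorphic to) a fork or an
antifork. -/
def Uncluttered {V : Type*} (G : SimpleGraph V) : Prop :=
  ¬ forkGraph.IsIndContained G ∧ ¬ antiforkGraph.IsIndContained G

/-!
A minimal counterexample to `χ ≤ 2 ω` is vertex-critical, and it is prime: a maximal proper module
containing both an edge and a non-edge could still be enlarged, and a nontrivial module that is a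
clique yields one that is not. In a prime uncluttered graph the non-neighbourhood of the centre of
any claw is bipartite, because an odd hole in it would give rise to a nontrivial module. If `v` is
the centre of a claw, two colours therefore suffice for `v` and its non-neighbours, and by
minimality `2 (ω - 1)` colours suffice for its neighbours. If there is no claw, then every
neighbourhood is a union of two cliques: it is triangle-free in the complement, and an odd hole
there would produce a claw. Every vertex then has at most `2 (ω - 1)` neighbours, which contradicts
criticality.
-/

namespace Uncluttered

open SimpleGraph

variable {V : Type*} {G : SimpleGraph V}

/-- A graph is fork-free if the fork is not an induced subgraph of it. Being uncluttered means that
the graph and its complement are both fork-free. -/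
def ForkFree (G : SimpleGraph V) : Prop := ¬ forkGraph.IsIndContained G

lemma forkFree (hG : Uncluttered G) : ForkFree G := hG.1

lemma compl (hG : Uncluttered G) : Uncluttered Gᶜ :=
  ⟨fun h => hG.2 (by simpa [antiforkGraph] using compl_isIndContained_compl.2 h),
    fun h => hG.1 (compl_isIndContained_compl.1 h)⟩

lemma induce (hG : Uncluttered G) (s : Set V) : Uncluttered (G.induce s) :=
  ⟨fun h => hG.1 (h.trans ⟨Embedding.induce s⟩), fun h => hG.2 (h.trans ⟨Embedding.induce s⟩)⟩

lemma forkGraph_adj {i j : Fin 5} : forkGraph.Adj i j ↔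
    s(i, j) ∈ ({s(0, 1), s(1, 2), s(2, 3), s(1, 4)} : Finset (Sym2 (Fin 5))) := by
  simp only [forkGraph, fromEdgeSet_adj]
  revert i j
  decide

lemma isIndContained_forkGraph {c l₁ l₂ p e : V} (h : Gᶜ.Adj l₁ l₂) (h₁ : G.Adj c l₁)
    (h₂ : G.Adj c l₂) (hp : G.Adj c p) (hpe : G.Adj p e) (h₁p : ¬ G.Adj l₁ p)
    (h₂p : ¬ G.Adj l₂ p) (hec : ¬ G.Adj e c) (he₁ : ¬ G.Adj e l₁) (he₂ : ¬ G.Adj e l₂) :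
    forkGraph.IsIndContained G := by
  have hadj (i j : Fin 5) :
      G.Adj (![l₁, c, p, e, l₂] i) (![l₁, c, p, e, l₂] j) ↔ forkGraph.Adj i j := by
    rw [forkGraph_adj]
    fin_cases i <;> fin_cases j <;> simp_all [G.adj_comm]
  have hinj : Function.Injective ![l₁, c, p, e, l₂] := by
    intro i j hij
    fin_cases i <;> fin_cases j <;> simp_all [G.adj_comm]
  exact ⟨⟨![l₁, c, p, e, l₂], hinj⟩, hadj _ _⟩

lemma ForkFree.adj_or_adj (hG : ForkFree G) {c l₁ l₂ p e : V} (h : Gᶜ.Adj l₁ l₂) (h₁ : G.Adj c l₁)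
    (h₂ : G.Adj c l₂) (hp : G.Adj c p) (hpe : G.Adj p e) (h₁p : ¬ G.Adj l₁ p)
    (h₂p : ¬ G.Adj l₂ p) (hec : ¬ G.Adj e c) : G.Adj e l₁ ∨ G.Adj e l₂ := by
  by_contra! he
  exact hG (isIndContained_forkGraph h h₁ h₂ hp hpe h₁p h₂p hec he.1 he.2)

lemma ForkFree.adj_of_diamond (hG : ForkFree Gᶜ) {x y k w q : V} (hxy : G.Adj x y)
    (hkx : G.Adj k x) (hky : G.Adj k y) (hwx : G.Adj w x) (hwy : G.Adj w y) (hkw : ¬ G.Adj k w)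
    (hqk : G.Adj q k) (hqx : ¬ G.Adj q x) (hqy : ¬ G.Adj q y) : G.Adj q w := by
  by_contra hqw
  have hne_x : q ≠ x := by rintro rfl; exact hqy hxy
  have hne_y : q ≠ y := by rintro rfl; exact hqx hxy.symm
  have hne_w : q ≠ w := by rintro rfl; exact hqx hwx
  have hne_k : k ≠ w := by rintro rfl; exact hqw hqk
  rcases hG.adj_or_adj (c := q) (l₁ := x) (l₂ := y) (p := w) (e := k) (by simpa using hxy)
    ⟨hne_x, hqx⟩ ⟨hne_y, hqy⟩ ⟨hne_w, hqw⟩ ⟨hne_k.symm, fun h => hkw h.symm⟩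
    (fun h => h.2 hwx.symm) (fun h => h.2 hwy.symm) (fun h => h.2 hqk.symm) with h | h
  exacts [h.2 hkx, h.2 hky]

lemma eq_univ_of_preconnected (hG : G.Preconnected) {S : Set V} (hS : S.Nonempty)
    (hclosed : ∀ x ∈ S, ∀ y, G.Adj x y → y ∈ S) : S = Set.univ := by
  obtain ⟨x, hx⟩ := hS
  rw [Set.eq_univ_iff_forall]
  by_contra! hy
  obtain ⟨y, hy⟩ := hy
  obtain ⟨d, -, hd, hd'⟩ := (hG x y).some.exists_boundary_dart S hx hy
  exact hd' (hclosed _ hd _ d.adj)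

lemma of_preconnected_induce {D : Set V} (hD : (G.induce D).Preconnected) {p : V → Prop}
    (hp : ∀ x ∈ D, ∀ y ∈ D, G.Adj x y → p x → p y) {x y : V} (hx : x ∈ D) (hy : y ∈ D)
    (hpx : p x) : p y := by
  have h := eq_univ_of_preconnected hD (S := {z : D | p z}) ⟨⟨x, hx⟩, hpx⟩
    fun a ha b hab => hp a a.2 b b.2 hab ha
  exact h.ge (Set.mem_univ ⟨y, hy⟩)

lemma connected_induce_insert {S : Set V} (hS : (G.induce S).Preconnected) {x y : V} (hx : x ∈ S)
    (hxy : G.Adj x y) : (G.induce (insert y S)).Connected := by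
  have hconn : (G.induce (S ∪ {x, y})).Connected :=
    induce_union_connected hS (induce_pair_connected_of_adj hxy).preconnected ⟨x, hx, by simp⟩
  rwa [Set.union_insert, Set.union_singleton,
    Set.insert_eq_of_mem (Set.mem_insert_of_mem y hx)] at hconn

lemma exists_preconnected_component (G : SimpleGraph V) {U : Set V} {t : V} (ht : t ∈ U) :
    ∃ D ⊆ U, t ∈ D ∧ (G.induce D).Preconnected ∧ ∀ x ∈ D, ∀ y ∈ U, G.Adj x y → y ∈ D := by
  let F : Set (Set V) := {S | S ⊆ U ∧ t ∈ S ∧ (G.induce S).Connected}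
  have htF : {t} ∈ F := ⟨by simpa using ht, rfl, by simp⟩
  refine ⟨⋃₀ F, Set.sUnion_subset fun S hS => hS.1, ⟨_, htF, rfl⟩, ?_, ?_⟩
  · exact (induce_sUnion_connected_of_pairwise_not_disjoint ⟨_, htF⟩
      (fun hS hT => ⟨t, hS.2.1, hT.2.1⟩) fun hS => hS.2.2).preconnected
  · rintro x ⟨S, hS, hx⟩ y hy hxy
    exact ⟨_, ⟨Set.insert_subset hy hS.1, Or.inr hS.2.1,
      connected_induce_insert hS.2.2.preconnected hx hxy⟩, Set.mem_insert y S⟩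

/-- The set of vertices complete to `X`. In the complement graph it becomes the set of vertices
outside `X` that are anticomplete to `X`. -/
def commonNbrs (G : SimpleGraph V) (X : Set V) : Set V := {v | ∀ x ∈ X, G.Adj v x}

/-- A module (homogeneous set) of `G`: every vertex outside `X` is complete or anticomplete
to `X`. -/
def IsModule (G : SimpleGraph V) (X : Set V) : Prop :=
  ∀ v ∉ X, v ∈ commonNbrs G X ∨ v ∈ commonNbrs Gᶜ X

/-- A graph is prime if its only modules are the empty set, the singletons and the whole vertex
set. -/
def IsPrime (G : SimpleGraph V) : Prop :=
  ∀ X : Set V, IsModule G X → X ≠ Set.univ → X.Subsingleton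

lemma notMem_of_mem_commonNbrs {X : Set V} {v : V} (hv : v ∈ commonNbrs G X) : v ∉ X :=
  fun h => G.irrefl (hv v h)

lemma IsModule.compl {X : Set V} (hX : IsModule G X) : IsModule Gᶜ X := by
  simpa [IsModule, or_comm] using hX

lemma IsModule.of_compl {X : Set V} (hX : IsModule Gᶜ X) : IsModule G X := by
  simpa using hX.compl

lemma IsPrime.compl (hG : IsPrime G) : IsPrime Gᶜ := fun X hX => hG X hX.of_compl

lemma IsModule.mem_commonNbrs {X : Set V} (hX : IsModule G X) {v x : V} (hv : v ∉ X) (hx : x ∈ X)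
    (hvx : G.Adj v x) : v ∈ commonNbrs G X :=
  (hX v hv).resolve_right fun h => (h x hx).2 hvx

lemma IsModule.of_preconnected {D : Set V} (hD : (G.induce D).Preconnected)
    (h : ∀ w ∉ D, ∀ x ∈ D, ∀ y ∈ D, G.Adj x y → G.Adj w x → G.Adj w y) : IsModule G D := by
  intro w hw
  by_cases hx : ∃ x ∈ D, G.Adj w x
  · obtain ⟨x, hx, hwx⟩ := hx
    exact Or.inl fun y hy => of_preconnected_induce hD (h w hw) hx hy hwx
  · push Not at hx
    exact Or.inr fun y hy => ⟨fun e => hw (e ▸ hy), hx y hy⟩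

lemma adj_of_mem_commonNbrs (hG : ForkFree G) {X : Set V} {e f n k l : V} (he : e ∈ X) (hf : f ∈ X)
    (hef : Gᶜ.Adj e f) (hn : n ∈ commonNbrs G X) (hk : k ∈ commonNbrs Gᶜ X)
    (hl : l ∈ commonNbrs Gᶜ X) (hkl : G.Adj k l) (hnk : G.Adj n k) : G.Adj n l := by
  by_contra hnl
  rcases hG.adj_or_adj hef (hn e he) (hn f hf) hnk hkl (fun h => (hk e he).2 h.symm)
    (fun h => (hk f hf).2 h.symm) (fun h => hnl h.symm) with h | h
  exacts [(hl e he).2 h, (hl f hf).2 h]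

lemma adj_iff_of_mem_commonNbrs (hG : ForkFree G) {X : Set V} {e f n k l : V} (he : e ∈ X)
    (hf : f ∈ X) (hef : Gᶜ.Adj e f) (hn : n ∈ commonNbrs G X) (hk : k ∈ commonNbrs Gᶜ X)
    (hl : l ∈ commonNbrs Gᶜ X) (hkl : G.Adj k l) : G.Adj n k ↔ G.Adj n l :=
  ⟨adj_of_mem_commonNbrs hG he hf hef hn hk hl hkl,
    adj_of_mem_commonNbrs hG he hf hef hn hl hk hkl.symm⟩

lemma adj_iff_of_mem_commonNbrs_compl (hG : ForkFree Gᶜ) {X : Set V} {e f n k l : V} (he : e ∈ X)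
    (hf : f ∈ X) (hef : G.Adj e f) (hn : n ∈ commonNbrs Gᶜ X) (hk : k ∈ commonNbrs G X)
    (hl : l ∈ commonNbrs G X) (hkl : Gᶜ.Adj k l) : G.Adj n k ↔ G.Adj n l := by
  have hne {z : V} (hz : z ∈ commonNbrs G X) : n ≠ z := by
    rintro rfl
    exact (hn e he).2 (hz e he)
  have h := adj_iff_of_mem_commonNbrs hG he hf (by simpa using hef) hn (by simpa using hk)
    (by simpa using hl) hkl
  simpa only [compl_adj, hne hk, hne hl, ne_eq, not_false_eq_true, true_and, not_iff_not] using h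

/-- The claw with centre `v` and leaves `s 0`, `s 1`, `s 2`. In the complement graph this is a
triangle in the non-neighbourhood of `v`. -/
structure IsClawAt (G : SimpleGraph V) (v : V) (s : Fin 3 → V) : Prop where
  adj : ∀ i, G.Adj v (s i)
  pairwise : Pairwise fun i j => Gᶜ.Adj (s i) (s j)

lemma isClawAt_of_adj {v x y z : V} (hx : G.Adj v x) (hy : G.Adj v y) (hz : G.Adj v z)
    (hxy : Gᶜ.Adj x y) (hxz : Gᶜ.Adj x z) (hyz : Gᶜ.Adj y z) : IsClawAt G v ![x, y, z] where
  adj := by simp [Fin.forall_fin_succ, hx, hy, hz]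
  pairwise i j hij := by
    fin_cases i <;> fin_cases j <;> simp_all [-compl_adj, Gᶜ.adj_comm]

lemma exists_ne_and_and {p : Fin 3 → Prop} (hp : ∀ i j, i ≠ j → p i ∨ p j) :
    ∃ i j, i ≠ j ∧ p i ∧ p j := by
  have h01 := hp 0 1 (by decide)
  have h02 := hp 0 2 (by decide)
  have h12 := hp 1 2 (by decide)
  simp only [Fin.exists_fin_succ]
  grind

lemma exists_fin_three_ne (i : Fin 3) : ∃ j k, j ≠ i ∧ k ≠ i ∧ j ≠ k := by
  revert i
  decide

namespace IsClawAt

variable {v : V} {s : Fin 3 → V}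

lemma not_adj (hs : IsClawAt G v s) (i j : Fin 3) : ¬ G.Adj (s i) (s j) := by
  rcases eq_or_ne i j with rfl | hij
  exacts [G.irrefl, (hs.pairwise hij).2]

lemma adj_or_adj (hG : ForkFree G) (hs : IsClawAt G v s) {m : V} (hm : ¬ G.Adj m v)
    {i j k : Fin 3} (h : G.Adj m (s i)) (hjk : j ≠ k) : G.Adj m (s j) ∨ G.Adj m (s k) :=
  hG.adj_or_adj (hs.pairwise hjk) (hs.adj j) (hs.adj k) (hs.adj i) h.symm (hs.not_adj j i)
    (hs.not_adj k i) hm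

lemma exists_leaf_ne (hG : ForkFree G) (hs : IsClawAt G v s) {m : V} (hm : ¬ G.Adj m v)
    {i : Fin 3} (h : G.Adj m (s i)) (j : Fin 3) : ∃ k ≠ j, G.Adj m (s k) := by
  obtain ⟨k, l, hk, hl, hkl⟩ := exists_fin_three_ne j
  rcases hs.adj_or_adj hG hm h hkl with h' | h'
  exacts [⟨k, hk, h'⟩, ⟨l, hl, h'⟩]

lemma exists_common_leaf (hG : ForkFree G) (hs : IsClawAt G v s) {m m' : V} (hm : ¬ G.Adj m v)
    (hm' : ¬ G.Adj m' v) {i i' : Fin 3} (h : G.Adj m (s i)) (h' : G.Adj m' (s i')) :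
    ∃ j, G.Adj m (s j) ∧ G.Adj m' (s j) := by
  obtain ⟨j, hji, hj⟩ := hs.exists_leaf_ne hG hm h i
  rcases hs.adj_or_adj hG hm' h' hji with hc | hc
  exacts [⟨j, hj, hc⟩, ⟨i, h, hc⟩]

lemma adj_of_adj (hG : ForkFree G) (hs : IsClawAt G v s) {w d e : V} (hde : G.Adj d e)
    (hvd : ¬ G.Adj v d) (hd : ∀ i, ¬ G.Adj d (s i)) (he : ∀ i, ¬ G.Adj e (s i))
    (hw : G.Adj w v ∨ ∃ i, G.Adj w (s i)) (hwd : G.Adj w d) : G.Adj w e := by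
  by_contra hwe
  have not_two {i j : Fin 3} (hij : i ≠ j) (hi : G.Adj w (s i)) (hj : G.Adj w (s j)) : False := by
    rcases hG.adj_or_adj (hs.pairwise hij) hi hj hwd hde (fun h => hd i h.symm)
      (fun h => hd j h.symm) (fun h => hwe h.symm) with h | h
    exacts [he i h, he j h]
  by_cases hwv : G.Adj w v
  · obtain ⟨i, j, hij, hi, hj⟩ : ∃ i j, i ≠ j ∧ G.Adj w (s i) ∧ G.Adj w (s j) := by
      refine exists_ne_and_and fun i j hij => ?_
      by_contra! hn
      rcases hG.adj_or_adj (hs.pairwise hij) (hs.adj i) (hs.adj j) hwv.symm hwd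
        (fun h => hn.1 h.symm) (fun h => hn.2 h.symm) (fun h => hvd h.symm) with h | h
      exacts [hd i h, hd j h]
    exact not_two hij hi hj
  · obtain ⟨i, hi⟩ := hw.resolve_left hwv
    obtain ⟨j, hji, hj⟩ := hs.exists_leaf_ne hG hwv hi i
    exact not_two hji hj hi

lemma not_adj_of_isPrime (hG : ForkFree G) (hP : IsPrime G) (hs : IsClawAt G v s) {t t' : V}
    (hvt : ¬ G.Adj v t) (hvt' : ¬ G.Adj v t') (ht : ∀ i, ¬ G.Adj t (s i))
    (ht' : ∀ i, ¬ G.Adj t' (s i)) : ¬ G.Adj t t' := by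
  intro htt
  obtain ⟨D, hDU, htD, hconn, hclosed⟩ :=
    exists_preconnected_component G (U := {x | ¬ G.Adj v x ∧ ∀ i, ¬ G.Adj x (s i)}) ⟨hvt, ht⟩
  have hD : IsModule G D := by
    refine .of_preconnected hconn fun w hw d hd e he hde hwd => ?_
    refine hs.adj_of_adj hG hde (hDU hd).1 (hDU hd).2 (hDU he).2 ?_ hwd
    by_contra! hn
    exact hw (hclosed d hd w ⟨fun h => hn.1 h.symm, hn.2⟩ hwd.symm)
  have hne : D ≠ Set.univ := fun h => (hDU (h ▸ Set.mem_univ (s 0))).1 (hs.adj 0)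
  exact htt.ne (hP D hD hne htD (hclosed t htD t' ⟨hvt', ht'⟩ htt))

lemma false_of_compl (hG : Uncluttered G) (hP : IsPrime G) {t : Fin 3 → V} (hs : IsClawAt G v s)
    (ht : IsClawAt Gᶜ v t) : False := by
  have hvt (l : Fin 3) : ¬ G.Adj (t l) v := fun h => (ht.adj l).2 h.symm
  have hne (i l : Fin 3) : s i ≠ t l := fun h => hvt l (h ▸ (hs.adj i).symm)
  have hcompl (i l : Fin 3) : Gᶜ.Adj (s i) (t l) ↔ ¬ G.Adj (t l) (s i) := by
    simp [hne, G.adj_comm]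
  have not_both_anticomplete (l l' : Fin 3) (hll' : l ≠ l') :
      (∃ i, G.Adj (t l) (s i)) ∨ ∃ i, G.Adj (t l') (s i) := by
    by_contra! hn
    exact hs.not_adj_of_isPrime hG.forkFree hP (fun h => hvt l h.symm) (fun h => hvt l' h.symm)
      hn.1 hn.2 (by simpa using ht.pairwise hll')
  have complete_of_two {i l l' : Fin 3} (hll' : l ≠ l') (h : G.Adj (t l) (s i))
      (h' : G.Adj (t l') (s i)) (m : Fin 3) : G.Adj (t m) (s i) := by
    by_contra hm
    rcases ht.adj_or_adj hG.compl.forkFree (fun h => h.2 (hs.adj i).symm) ((hcompl i m).2 hm) hll'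
      with hc | hc
    exacts [(hcompl i l).1 hc h, (hcompl i l').1 hc h']
  obtain ⟨l, l', hll', ⟨i, hi⟩, ⟨i', hi'⟩⟩ := exists_ne_and_and not_both_anticomplete
  obtain ⟨j, hj, hj'⟩ := hs.exists_common_leaf hG.forkFree (hvt l) (hvt l') hi hi'
  have hj_complete := complete_of_two hll' hj hj'
  choose f hfj hf using fun m =>
    hs.exists_leaf_ne hG.forkFree (hvt m) (hj_complete m) j
  obtain ⟨m, m', hfm, hmm'⟩ : ∃ m m', f m = f m' ∧ m ≠ m' := by
    refine Function.not_injective_iff.1 fun hinj => ?_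
    obtain ⟨m, hm⟩ := Finite.surjective_of_injective hinj j
    exact hfj m hm
  have hk_complete := complete_of_two hmm' (hf m) (hfm ▸ hf m')
  exact ht.not_adj_of_isPrime hG.compl.forkFree hP.compl (fun h => h.2 (hs.adj j))
    (fun h => h.2 (hs.adj (f m))) (fun l h => (hcompl j l).1 h (hj_complete l))
    (fun l h => (hcompl (f m) l).1 h (hk_complete l)) (hs.pairwise (hfj m).symm)

end IsClawAt

lemma ForkFree.induce (hG : ForkFree G) (s : Set V) : ForkFree (G.induce s) :=
  fun h => hG (h.trans ⟨Embedding.induce s⟩)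

lemma nonempty_coloring_sum {α β : Type*} {X : Set V} (C : (G.induce X).Coloring α)
    (D : (G.induce Xᶜ).Coloring β) : Nonempty (G.Coloring (α ⊕ β)) := by
  classical
  refine ⟨.mk (fun x => if hx : x ∈ X then .inl (C ⟨x, hx⟩) else .inr (D ⟨x, hx⟩)) ?_⟩
  intro x y hxy
  by_cases hx : x ∈ X <;> by_cases hy : y ∈ X <;> simp only [hx, hy, dite_true, dite_false, ne_eq,
    Sum.inl.injEq, Sum.inr.injEq, reduceCtorEq, not_false_eq_true]
  · exact C.valid (v := ⟨x, hx⟩) (w := ⟨y, hy⟩) hxy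
  · exact D.valid (v := ⟨x, hx⟩) (w := ⟨y, hy⟩) hxy

lemma colorable_add {X : Set V} {m n : ℕ} (hX : (G.induce X).Colorable m)
    (hXc : (G.induce Xᶜ).Colorable n) : G.Colorable (m + n) := by
  obtain ⟨C⟩ := hX
  obtain ⟨D⟩ := hXc
  obtain ⟨E⟩ := nonempty_coloring_sum C D
  simpa using E.colorable

lemma colorable_of_no_adj {X : Set V} {n : ℕ} (hX : (G.induce X).Colorable n)
    (hXc : (G.induce Xᶜ).Colorable n) (h : ∀ x ∈ X, ∀ y ∉ X, ¬ G.Adj x y) : G.Colorable n := by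
  classical
  obtain ⟨C⟩ := hX
  obtain ⟨D⟩ := hXc
  refine ⟨.mk (fun x => if hx : x ∈ X then C ⟨x, hx⟩ else D ⟨x, hx⟩) fun {x y} hxy => ?_⟩
  by_cases hx : x ∈ X <;> by_cases hy : y ∈ X <;> simp only [hx, hy, dite_true, dite_false]
  · exact C.valid (v := ⟨x, hx⟩) (w := ⟨y, hy⟩) hxy
  · exact absurd hxy (h x hx y hy)
  · exact absurd hxy.symm (h y hy x hx)
  · exact D.valid (v := ⟨x, hx⟩) (w := ⟨y, hy⟩) hxy

lemma nonempty_coloring_of_forall_ne {α : Type*} {v : V} (C : (G.induce {v}ᶜ).Coloring α) {a : α}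
    (ha : ∀ u : ({v}ᶜ : Set V), G.Adj v u → C u ≠ a) : Nonempty (G.Coloring α) := by
  classical
  refine ⟨.mk (fun x => if hx : x = v then a else C ⟨x, hx⟩) fun {x y} hxy => ?_⟩
  by_cases hx : x = v <;> by_cases hy : y = v <;> simp only [hx, hy, dite_true, dite_false]
  · exact absurd (hx.trans hy.symm) hxy.ne
  · exact (ha ⟨y, hy⟩ (hx ▸ hxy)).symm
  · exact ha ⟨x, hx⟩ (hy ▸ hxy.symm)
  · exact C.valid (v := ⟨x, hx⟩) (w := ⟨y, hy⟩) hxy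

lemma isBipartite_of_preconnected (hG : G.Preconnected) {S : Set V} (hS : S.Nonempty)
    (hindep : ∀ x ∈ S, ∀ y ∈ S, ¬ G.Adj x y)
    (hclosed : ∀ x ∈ S, ∀ y z, G.Adj x y → G.Adj y z → z ∈ S) : G.IsBipartite := by
  have hdom : S ∪ {y | ∃ x ∈ S, G.Adj x y} = Set.univ := by
    refine eq_univ_of_preconnected hG (hS.mono Set.subset_union_left) ?_
    rintro x (hx | ⟨z, hz, hzx⟩) y hxy
    exacts [Or.inr ⟨x, hx, hxy⟩, Or.inl (hclosed z hz x y hzx hxy)]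
  refine IsBipartiteWith.isBipartite (s := S) (t := Sᶜ) ⟨disjoint_compl_right, fun x y hxy => ?_⟩
  by_cases hx : x ∈ S
  · exact Or.inl ⟨hx, fun hy => hindep x hx y hy hxy⟩
  · obtain ⟨z, hz, hzx⟩ := (hdom.ge (Set.mem_univ x)).resolve_left hx
    exact Or.inr ⟨hx, hclosed z hz x y hzx hxy⟩

lemma not_adj_of_cliqueFreeOn {M : Set V} (hM : G.CliqueFreeOn M 3) {x y z : V} (hx : x ∈ M)
    (hy : y ∈ M) (hz : z ∈ M) (hxy : G.Adj x y) (hxz : G.Adj x z) : ¬ G.Adj y z := by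
  classical
  intro hyz
  exact hM (t := {x, y, z}) (by simp [Set.insert_subset_iff, hx, hy, hz])
    (is3Clique_triple_iff.2 ⟨hxy, hxz, hyz⟩)

lemma IsClawAt.isBipartite (hG : ForkFree G) (hfree : G.CliqueFree 3) (hconn : G.Preconnected)
    {v : V} {s : Fin 3 → V} (hs : IsClawAt G v s) : G.IsBipartite := by
  have htri {x y z : V} : G.Adj x y → G.Adj x z → ¬ G.Adj y z :=
    not_adj_of_cliqueFreeOn (hfree.cliqueFreeOn (s := Set.univ)) trivial trivial trivial
  have hnv {x : V} {i : Fin 3} (h : G.Adj x (s i)) : ¬ G.Adj x v := fun hxv =>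
    htri hxv h (hs.adj i)
  refine isBipartite_of_preconnected hconn (S := {x | ∃ i, G.Adj x (s i)}) ⟨v, 0, hs.adj 0⟩ ?_ ?_
  · rintro x ⟨i, hi⟩ y ⟨j, hj⟩ hxy
    obtain ⟨k, hxk, hyk⟩ := hs.exists_common_leaf hG (hnv hi) (hnv hj) hi hj
    exact htri hxy hxk hyk
  · rintro x ⟨i, hi⟩ y z hxy hyz
    obtain ⟨j, hji, hj⟩ := hs.exists_leaf_ne hG (hnv hi) hi i
    rcases hG.adj_or_adj (hs.pairwise hji) hj hi hxy hyz (htri hj hxy) (htri hi hxy)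
      (fun h => htri hxy h.symm hyz) with h | h
    exacts [⟨j, h⟩, ⟨i, h⟩]

/-- `G` is not `n`-colourable but all its proper induced subgraphs are. (In the literature such a
graph is called `(n + 1)`-vertex-critical.) -/
structure IsVertexCritical (G : SimpleGraph V) (n : ℕ) : Prop where
  not_colorable : ¬ G.Colorable n
  induce_colorable : ∀ s : Set V, s ≠ Set.univ → (G.induce s).Colorable n

lemma exists_isVertexCritical [Finite V] {M : Set V} {n : ℕ} (hM : ¬ (G.induce M).Colorable n) :
    ∃ O ⊆ M, IsVertexCritical (G.induce O) n := by
  obtain ⟨O, hOM, hO⟩ :=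
    exists_minimal_le_of_wellFoundedLT (fun O : Set V => ¬ (G.induce O).Colorable n) M hM
  refine ⟨O, hOM, hO.1, fun s hs => ?_⟩
  have himage : (G.induce (Subtype.val '' s)).Colorable n := by
    by_contra hcol
    refine hs (Set.eq_univ_of_forall fun x => ?_)
    obtain ⟨y, hy, hyx⟩ := hO.2 hcol (Subtype.coe_image_subset O s) x.2
    rwa [← Subtype.ext hyx]
  exact himage.of_hom (G' := G.induce (Subtype.val '' s))
    ⟨fun x => ⟨x, x, x.2, rfl⟩, fun {_ _} hxy => hxy⟩

namespace IsVertexCritical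

variable {n : ℕ}

lemma preconnected (hG : IsVertexCritical G n) : G.Preconnected := by
  intro u v
  by_contra huv
  refine hG.not_colorable (colorable_of_no_adj (X := {w | G.Reachable u w})
    (hG.induce_colorable _ fun h => huv (h.ge (Set.mem_univ v)))
    (hG.induce_colorable _ fun h => h.ge (Set.mem_univ u) (Reachable.refl u)) ?_)
  exact fun x hx y hy hxy => hy (hx.trans hxy.reachable)

lemma exists_adj_not_adj (hG : IsVertexCritical G n) {x y : V} (hxy : Gᶜ.Adj x y) :
    ∃ z, G.Adj x z ∧ ¬ G.Adj y z := by
  by_contra! hdom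
  obtain ⟨C⟩ := hG.induce_colorable {x}ᶜ (by simp)
  exact hG.not_colorable (nonempty_coloring_of_forall_ne C (a := C ⟨y, hxy.ne'⟩)
    fun u hu => C.valid (hdom u hu).symm)

lemma le_encard_neighborSet (hG : IsVertexCritical G n) (v : V) :
    n ≤ (G.neighborSet v).encard := by
  by_contra! hlt
  obtain ⟨C⟩ := hG.induce_colorable {v}ᶜ (by simp)
  have hcard : (C '' (Subtype.val ⁻¹' G.neighborSet v)).encard < (Set.univ : Set (Fin n)).encard :=
    calc
      _ ≤ (Subtype.val ⁻¹' G.neighborSet v).encard := Set.encard_image_le _ _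
      _ ≤ (G.neighborSet v).encard := Set.encard_preimage_val_le_encard_right _ _
      _ < n := hlt
      _ = _ := by simp
  obtain ⟨a, ha⟩ := (Set.ne_univ_iff_exists_notMem _).1 fun h => hcard.ne (congrArg Set.encard h)
  exact hG.not_colorable (nonempty_coloring_of_forall_ne C fun u hu hua => ha ⟨u, hu, hua⟩)

end IsVertexCritical

/-- `O` induces an odd hole which is a connected component of the triangle-free graph induced
on `M`. Instead of recording the cycle itself, one records that `O` is connected, that every vertex
of `O` has exactly two neighbours in `M`, both of them in `O`, and that `O` is not bipartite. -/
structure IsOddHole (G : SimpleGraph V) (M O : Set V) : Prop where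
  subset : O ⊆ M
  preconnected : (G.induce O).Preconnected
  not_isBipartite : ¬ (G.induce O).IsBipartite
  cliqueFreeOn : G.CliqueFreeOn O 3
  neighborSet_inter : ∀ x ∈ O, ∃ y ∈ O, ∃ z ∈ O, y ≠ z ∧ G.neighborSet x ∩ M = {y, z}

lemma isBipartite_of_three_nbrs (hG : ForkFree G) (hfree : G.CliqueFree 3)
    (hconn : G.Preconnected) {x y z u : V} (hxy : G.Adj x y) (hxz : G.Adj x z) (hxu : G.Adj x u)
    (hyz : y ≠ z) (hyu : y ≠ u) (hzu : z ≠ u) : G.IsBipartite := by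
  have hindep := isIndepSet_neighborSet_of_triangleFree G hfree x
  exact (isClawAt_of_adj hxy hxz hxu ⟨hyz, hindep hxy hxz hyz⟩ ⟨hyu, hindep hxy hxu hyu⟩
    ⟨hzu, hindep hxz hxu hzu⟩).isBipartite hG hfree hconn

lemma exists_isOddHole [Finite V] (hG : ForkFree G) {M : Set V}
    (hfree : (G.induce M).CliqueFree 3) (hM : ¬ (G.induce M).IsBipartite) :
    ∃ O, IsOddHole G M O := by
  rw [cliqueFree_induce_iff] at hfree
  obtain ⟨O, hOM, hO⟩ := exists_isVertexCritical hM
  refine ⟨O, hOM, hO.preconnected, hO.not_colorable, hfree.subset G hOM, fun x hx => ?_⟩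
  obtain ⟨y, z, hxy, hxz, hyz⟩ : ∃ y z : O, G.Adj x y ∧ G.Adj x z ∧ y ≠ z :=
    Set.one_lt_encard_iff.1 (lt_of_lt_of_le (by norm_num) (hO.le_encard_neighborSet ⟨x, hx⟩))
  refine ⟨y, y.2, z, z.2, Subtype.coe_ne_coe.2 hyz, Set.Subset.antisymm ?_ ?_⟩
  · rintro u ⟨hxu, huM⟩
    by_contra! hu
    rw [Set.mem_insert_iff, Set.mem_singleton_iff, not_or] at hu
    have hsub : O ⊆ insert u O := Set.subset_insert u O
    have hconn := (connected_induce_insert hO.preconnected hx hxu).preconnected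
    have hfree' : (G.induce (insert u O)).CliqueFree 3 :=
      (cliqueFree_induce_iff G _ _).2 (hfree.subset G (Set.insert_subset huM hOM))
    have hbip := isBipartite_of_three_nbrs (hG.induce (insert u O)) hfree' hconn
      (x := ⟨x, hsub hx⟩) (y := ⟨y, hsub y.2⟩) (z := ⟨z, hsub z.2⟩) (u := ⟨u, Or.inl rfl⟩)
      hxy hxz hxu (fun h => hyz (Subtype.ext (Subtype.mk.inj h)))
      (fun h => hu.1 (congrArg Subtype.val h).symm) fun h => hu.2 (congrArg Subtype.val h).symm
    exact hO.not_colorable (hbip.of_hom (G.induceHomOfLE hsub).toHom)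
  · rintro u (rfl | rfl)
    exacts [⟨hxy, hOM y.2⟩, ⟨hxz, hOM z.2⟩]

namespace IsOddHole

variable {M O : Set V}

lemma nonempty (hO : IsOddHole G M O) : O.Nonempty := by
  by_contra h
  rw [Set.not_nonempty_iff_eq_empty] at h
  subst h
  exact hO.not_isBipartite (.of_isEmpty _)

lemma not_adj (hO : IsOddHole G M O) {x y z : V} (hx : x ∈ O) (hy : y ∈ O) (hz : z ∈ O)
    (hxy : G.Adj x y) (hxz : G.Adj x z) : ¬ G.Adj y z :=
  not_adj_of_cliqueFreeOn hO.cliqueFreeOn hx hy hz hxy hxz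

lemma mem_of_adj (hO : IsOddHole G M O) {x u : V} (hx : x ∈ O) (hu : u ∈ M) (hxu : G.Adj x u) :
    u ∈ O := by
  obtain ⟨y, hy, z, hz, -, hN⟩ := hO.neighborSet_inter x hx
  rcases hN.le ⟨hxu, hu⟩ with rfl | rfl <;> assumption

lemma exists_adj_ne (hO : IsOddHole G M O) {x : V} (hx : x ∈ O) (y : V) :
    ∃ z ∈ O, z ≠ y ∧ G.Adj x z := by
  obtain ⟨a, ha, b, hb, hab, hN⟩ := hO.neighborSet_inter x hx
  by_cases hay : a = y
  · exact ⟨b, hb, fun hby => hab (hay.trans hby.symm), (hN.ge (by simp)).1⟩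
  · exact ⟨a, ha, hay, (hN.ge (by simp)).1⟩

lemma eq_or_eq (hO : IsOddHole G M O) {x y z u : V} (hx : x ∈ O) (hy : y ∈ O) (hz : z ∈ O)
    (hu : u ∈ O) (hyz : y ≠ z) (hxy : G.Adj x y) (hxz : G.Adj x z) (hxu : G.Adj x u) :
    u = y ∨ u = z := by
  obtain ⟨a, -, b, -, -, hN⟩ := hO.neighborSet_inter x hx
  have hmem {w : V} (hw : w ∈ O) (hxw : G.Adj x w) : w = a ∨ w = b := hN.le ⟨hxw, hO.subset hw⟩
  grind

lemma not_four_cycle (hO : IsOddHole G M O) {a b c d : V} (ha : a ∈ O) (hb : b ∈ O) (hc : c ∈ O)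
    (hd : d ∈ O) (hab : G.Adj a b) (hbc : G.Adj b c) (hcd : G.Adj c d) (hda : G.Adj d a)
    (hac : a ≠ c) (hbd : b ≠ d) : False := by
  have hindep : ¬ G.Adj a c := fun h => hO.not_adj ha hb hc hab h hbc
  refine hO.not_isBipartite (isBipartite_of_preconnected hO.preconnected
    (S := {x : O | (x : V) = a ∨ (x : V) = c}) ⟨⟨a, ha⟩, Or.inl rfl⟩ ?_ ?_)
  · rintro ⟨x, hx⟩ (rfl | rfl) ⟨y, hy⟩ (rfl | rfl) hxy
    exacts [G.irrefl hxy, hindep hxy, hindep hxy.symm, G.irrefl hxy]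
  · rintro ⟨x, hx⟩ hxac ⟨y, hy⟩ ⟨z, hz⟩ hxy hyz
    have hybd : y = b ∨ y = d := by
      rcases hxac with rfl | rfl
      exacts [hO.eq_or_eq hx hb hd hy hbd hab hda.symm hxy,
        hO.eq_or_eq hx hb hd hy hbd hbc.symm hcd hxy]
    rcases hybd with rfl | rfl
    exacts [hO.eq_or_eq hy ha hc hz hac hab.symm hbc hyz,
      hO.eq_or_eq hy ha hc hz hac hda hcd.symm hyz]

lemma exists_compl_adj (hO : IsOddHole G M O) {p p' : V} (hp : p ∈ O) (hp' : p' ∈ O)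
    (hpp' : G.Adj p p') : ∃ r ∈ O, Gᶜ.Adj r p ∧ Gᶜ.Adj r p' := by
  obtain ⟨q, hq, hqp', hpq⟩ := hO.exists_adj_ne hp p'
  obtain ⟨r, hr, hrp, hqr⟩ := hO.exists_adj_ne hq p
  refine ⟨r, hr, ⟨hrp, fun h => hO.not_adj hp hq hr hpq h.symm hqr⟩, ?_, fun h => ?_⟩
  · rintro rfl
    exact hO.not_adj hp hq hr hpq hpp' hqr
  · exact hO.not_four_cycle hp hp' hr hq hpp' h.symm hqr.symm hpq.symm hrp.symm hqp'.symm

lemma adj_of_mixed (hG : ForkFree G) (hO : IsOddHole G M O) {v w x y z : V}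
    (hv : v ∈ commonNbrs Gᶜ M) (hvw : G.Adj v w) (hx : x ∈ O) (hy : y ∈ O) (hz : z ∈ O)
    (hyz : y ≠ z) (hxy : G.Adj x y) (hxz : G.Adj x z) (hwx : G.Adj w x) (hwy : ¬ G.Adj w y) :
    G.Adj w z := by
  have hvO {u : V} (hu : u ∈ O) : ¬ G.Adj v u := (hv u (hO.subset hu)).2
  by_contra hwz
  rcases hG.adj_or_adj ⟨hyz, hO.not_adj hx hy hz hxy hxz⟩ hxy hxz hwx.symm hvw.symm
    (fun h => hwy h.symm) (fun h => hwz h.symm) (hvO hx) with h | h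
  exacts [hvO hy h, hvO hz h]

lemma adj_or_adj_of_mixed (hG : ForkFree G) (hO : IsOddHole G M O) {v w x y z : V}
    (hv : v ∈ commonNbrs Gᶜ M) (hvw : G.Adj v w) (hx : x ∈ O) (hy : y ∈ O) (hz : z ∈ O)
    (hxy : G.Adj x y) (hwx : G.Adj w x) (hwy : ¬ G.Adj w y) (hwz : G.Adj w z) :
    G.Adj z x ∨ G.Adj z y := by
  by_contra! hn
  rcases hG.adj_or_adj (hv z (hO.subset hz)) hvw.symm hwz hwx hxy (hv x (hO.subset hx)).2 hn.1
    (fun h => hwy h.symm) with h | h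
  exacts [(hv y (hO.subset hy)).2 h.symm, hn.2 h.symm]

lemma exists_neighborSet_inter_eq_pair (hG : ForkFree G) (hO : IsOddHole G M O) {v w p₀ q₀ : V}
    (hv : v ∈ commonNbrs Gᶜ M) (hvw : G.Adj v w) (hp₀ : p₀ ∈ O) (hq₀ : q₀ ∈ O)
    (hwp₀ : G.Adj w p₀) (hwq₀ : ¬ G.Adj w q₀) :
    ∃ p ∈ O, ∃ p' ∈ O, G.Adj p p' ∧ G.neighborSet w ∩ O = {p, p'} := by
  obtain ⟨p, hp, q, hq, hpq, hwp, hwq⟩ : ∃ p ∈ O, ∃ q ∈ O, G.Adj p q ∧ G.Adj w p ∧ ¬ G.Adj w q := by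
    by_contra! hn
    exact hwq₀ (of_preconnected_induce hO.preconnected hn hp₀ hq₀ hwp₀)
  obtain ⟨p', hp', hp'q, hpp'⟩ := hO.exists_adj_ne hp q
  have hwp' : G.Adj w p' := hO.adj_of_mixed hG hv hvw hp hq hp' hp'q.symm hpq hpp' hwp hwq
  have eq_of_adj {z : V} (hz : z ∈ O) (hwz : G.Adj w z) (hpz : G.Adj p z) : z = p' :=
    (hO.eq_or_eq hp hq hp' hz hp'q.symm hpq hpp' hpz).resolve_left fun h => hwq (h ▸ hwz)
  refine ⟨p, hp, p', hp', hpp', Set.Subset.antisymm ?_ ?_⟩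
  · rintro z ⟨hwz, hz⟩
    by_contra! hne
    rw [Set.mem_insert_iff, Set.mem_singleton_iff, not_or] at hne
    have hzp : ¬ G.Adj z p := fun h => hne.2 (eq_of_adj hz hwz h.symm)
    have hzq : G.Adj z q :=
      (hO.adj_or_adj_of_mixed hG hv hvw hp hq hz hpq hwp hwq hwz).resolve_left hzp
    obtain ⟨z', hz', hz'q, hzz'⟩ := hO.exists_adj_ne hz q
    have hwz' : G.Adj w z' := hO.adj_of_mixed hG hv hvw hz hq hz' hz'q.symm hzq hzz' hwz hwq
    rcases hO.adj_or_adj_of_mixed hG hv hvw hp hq hz' hpq hwp hwq hwz' with h | h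
    · obtain rfl := eq_of_adj hz' hwz' h.symm
      exact hO.not_four_cycle hp hz' hz hq hpp' hzz'.symm hzq hpq.symm (Ne.symm hne.1) hp'q
    · exact hO.not_adj hz hz' hq hzz' hzq h
  · rintro z (rfl | rfl)
    exacts [⟨hwp, hp⟩, ⟨hwp', hp'⟩]

lemma exists_mixed_of_isPrime (hP : IsPrime G) {v : V} (hO : IsOddHole G (Gᶜ.neighborSet v) O) :
    ∃ w, G.Adj v w ∧ (∃ p ∈ O, G.Adj w p) ∧ ∃ q ∈ O, ¬ G.Adj w q := by
  by_contra! hn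
  have hmod : IsModule G O := by
    refine .of_preconnected hO.preconnected fun w hw x hx _ hy _ hwx => ?_
    by_cases hvw : G.Adj v w
    · exact hn w hvw ⟨x, hx, hwx⟩ _ hy
    · have hwv : v ≠ w := by rintro rfl; exact (hO.subset hx).2 hwx
      exact absurd (hO.mem_of_adj hx ⟨hwv, hvw⟩ hwx.symm) hw
  have hne : O ≠ Set.univ := fun h => Gᶜ.irrefl (hO.subset (h.ge (Set.mem_univ v)))
  obtain ⟨x, hx⟩ := hO.nonempty
  obtain ⟨y, hy, -, hxy⟩ := hO.exists_adj_ne hx x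
  exact hxy.ne (hP O hmod hne hx hy)

end IsOddHole

lemma cliqueFree_induce_compl_neighborSet {v : V} (h : ∀ t, ¬ IsClawAt Gᶜ v t) :
    (G.induce (Gᶜ.neighborSet v)).CliqueFree 3 := by
  classical
  rw [cliqueFree_induce_iff]
  intro t ht ht3
  obtain ⟨x, y, z, hxy, hxz, hyz, rfl⟩ := is3Clique_iff.1 ht3
  simp only [Finset.coe_insert, Finset.coe_singleton, Set.insert_subset_iff,
    Set.singleton_subset_iff] at ht
  exact h _ (isClawAt_of_adj ht.1 ht.2.1 ht.2.2 (by simpa using hxy) (by simpa using hxz)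
    (by simpa using hyz))

lemma isBipartite_induce_compl_neighborSet_of_forall_not_isClawAt [Finite V] (hG : ForkFree G)
    (hP : IsPrime G) (h : ∀ u t, ¬ IsClawAt Gᶜ u t) (v : V) :
    (G.induce (Gᶜ.neighborSet v)).IsBipartite := by
  by_contra hbip
  obtain ⟨O, hO⟩ := exists_isOddHole hG (cliqueFree_induce_compl_neighborSet (h v)) hbip
  obtain ⟨w, hvw, ⟨p₀, hp₀, hwp₀⟩, q₀, hq₀, hwq₀⟩ := hO.exists_mixed_of_isPrime hP
  obtain ⟨p, hp, p', hp', hpp', hN⟩ :=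
    hO.exists_neighborSet_inter_eq_pair hG (fun _ hx => hx) hvw hp₀ hq₀ hwp₀ hwq₀
  obtain ⟨r, hr, hrp, hrp'⟩ := hO.exists_compl_adj hp hp' hpp'
  have hwp : G.Adj w p := (hN.ge (by simp)).1
  have hwp' : G.Adj w p' := (hN.ge (by simp)).1
  have hrw : Gᶜ.Adj r w := by
    refine ⟨?_, fun hrw => ?_⟩
    · rintro rfl
      exact (hO.subset hr).2 hvw
    · rcases hN.le ⟨hrw.symm, hr⟩ with rfl | rfl
      exacts [Gᶜ.irrefl hrp, Gᶜ.irrefl hrp']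
  exact h r _ (isClawAt_of_adj hrw hrp hrp' (by simpa using hwp) (by simpa using hwp')
    (by simpa using hpp'))

namespace IsOddHole

variable {M O : Set V} {v : V}

lemma adj_of_mixed_of_adj_of_adj (hG : ForkFree G) (hO : IsOddHole G M O) {w x y q : V}
    (hv : v ∈ commonNbrs Gᶜ M) (hvw : G.Adj v w) (hx : x ∈ O) (hy : y ∈ O) (hq : q ∈ O)
    (hxy : x ≠ y) (hwx : G.Adj w x) (hwy : G.Adj w y) (hwq : ¬ G.Adj w q) : G.Adj x y := by
  obtain ⟨a, -, b, -, hab, hN⟩ := hO.exists_neighborSet_inter_eq_pair hG hv hvw hx hq hwx hwq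
  rcases hN.le ⟨hwx, hx⟩ with rfl | rfl <;> rcases hN.le ⟨hwy, hy⟩ with rfl | rfl
  exacts [absurd rfl hxy, hab, hab.symm, absurd rfl hxy]

lemma exists_adj_of_mixed (hG : ForkFree G) (hO : IsOddHole G M O) {w p q : V}
    (hv : v ∈ commonNbrs Gᶜ M) (hvw : G.Adj v w) (hp : p ∈ O) (hq : q ∈ O) (hwp : G.Adj w p)
    (hwq : ¬ G.Adj w q) : ∃ p' ∈ O, G.Adj p p' ∧ G.Adj w p' := by
  obtain ⟨a, ha, b, hb, hab, hN⟩ := hO.exists_neighborSet_inter_eq_pair hG hv hvw hp hq hwp hwq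
  rcases hN.le ⟨hwp, hp⟩ with rfl | rfl
  exacts [⟨b, hb, hab, (hN.ge (by simp)).1⟩, ⟨a, ha, hab.symm, (hN.ge (by simp)).1⟩]

lemma adj_of_mixed_of_mem_commonNbrs (hG : Uncluttered G) (hO : IsOddHole G M O) {k w p q : V}
    (hv : v ∈ commonNbrs Gᶜ M) (hvw : G.Adj v w) (hk : k ∈ commonNbrs G O) (hp : p ∈ O)
    (hq : q ∈ O) (hwp : G.Adj w p) (hwq : ¬ G.Adj w q) : G.Adj w k := by
  obtain ⟨a, ha, b, hb, hab, hN⟩ :=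
    hO.exists_neighborSet_inter_eq_pair hG.forkFree hv hvw hp hq hwp hwq
  obtain ⟨r, hr, hra, hrb⟩ := hO.exists_compl_adj ha hb hab
  have hwa : G.Adj w a := (hN.ge (by simp)).1
  have hwb : G.Adj w b := (hN.ge (by simp)).1
  by_contra hwk
  have hrw : G.Adj r w := hG.compl.forkFree.adj_of_diamond hab (hk a ha) (hk b hb) hwa hwb
    (fun h => hwk h.symm) (hk r hr).symm hra.2 hrb.2
  rcases hN.le ⟨hrw.symm, hr⟩ with rfl | rfl
  exacts [Gᶜ.irrefl hra, Gᶜ.irrefl hrb]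

lemma adj_of_anticomplete_of_mem_commonNbrs (hG : ForkFree G) (hO : IsOddHole G M O) {k l : V}
    (hv : v ∈ commonNbrs Gᶜ M) (hvk : G.Adj v k) (hvl : G.Adj v l) (hk : k ∈ commonNbrs G O)
    (hl : ∀ x ∈ O, ¬ G.Adj l x) : G.Adj l k := by
  obtain ⟨a, ha⟩ := hO.nonempty
  obtain ⟨b, hb, -, hab⟩ := hO.exists_adj_ne ha a
  obtain ⟨r, hr, hra, -⟩ := hO.exists_compl_adj ha hb hab
  by_contra hlk
  rcases hG.adj_or_adj hra (hk r hr) (hk a ha) hvk.symm hvl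
    (fun h => (hv r (hO.subset hr)).2 h.symm) (fun h => (hv a (hO.subset ha)).2 h.symm) hlk
    with h | h
  exacts [hl r hr h, hl a ha h]

lemma mem_commonNbrs_or_anticomplete_leaf (hG : Uncluttered G) (hO : IsOddHole G M O)
    {s : Fin 3 → V} (hs : IsClawAt G v s) (hv : v ∈ commonNbrs Gᶜ M) (i : Fin 3) :
    s i ∈ commonNbrs G O ∨ ∀ x ∈ O, ¬ G.Adj (s i) x := by
  by_contra! hmixed
  obtain ⟨hi, p, hp, hip⟩ := hmixed
  obtain ⟨q₀, hq₀, hiq₀⟩ : ∃ q ∈ O, ¬ G.Adj (s i) q := by simpa [commonNbrs] using hi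
  have hOv {x : V} (hx : x ∈ O) : ¬ G.Adj x v := fun h => (hv x (hO.subset hx)).2 h.symm
  have adj_of_leaf {j : Fin 3} {x y : V} (hx : x ∈ O) (hy : y ∈ O) (hxy : x ≠ y)
      (hjx : G.Adj (s j) x) (hjy : G.Adj (s j) y) : G.Adj x y := by
    obtain ⟨z, hz, hjz⟩ : ∃ z ∈ O, ¬ G.Adj (s j) z := by
      by_contra! hj
      exact hs.not_adj i j (hO.adj_of_mixed_of_mem_commonNbrs hG hv (hs.adj i) hj hp hq₀ hip hiq₀)
    exact hO.adj_of_mixed_of_adj_of_adj hG.forkFree hv (hs.adj j) hx hy hz hxy hjx hjy hjz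
  have adj_or_adj_leaf {j k : Fin 3} (hjk : j ≠ k) {x y : V} (hx : x ∈ O) (hy : y ∈ O)
      (hxy : G.Adj x y) (hxj : G.Adj x (s j)) (hxk : G.Adj x (s k)) :
      G.Adj (s j) y ∨ G.Adj (s k) y := by
    by_contra! hn
    obtain ⟨r, hr, hrx, hyr⟩ := hO.exists_adj_ne hy x
    have hxr : ¬ G.Adj r x := hO.not_adj hy hr hx hyr hxy.symm
    rcases hG.forkFree.adj_or_adj (hs.pairwise hjk) hxj hxk hxy hyr hn.1 hn.2 hxr with h | h
    exacts [hxr (adj_of_leaf hr hx hrx h.symm hxj.symm),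
      hxr (adj_of_leaf hr hx hrx h.symm hxk.symm)]
  obtain ⟨p', hp', hpp', hip'⟩ := hO.exists_adj_of_mixed hG.forkFree hv (hs.adj i) hp hq₀ hip hiq₀
  obtain ⟨q, hq, hqp', hpq⟩ := hO.exists_adj_ne hp p'
  have hqp'_not : ¬ G.Adj q p' := hO.not_adj hp hq hp' hpq hpp'
  have hiq : ¬ G.Adj (s i) q := fun h => hqp'_not (adj_of_leaf hq hp' hqp' h hip')
  obtain ⟨j, hji, hpj⟩ := hs.exists_leaf_ne hG.forkFree (hOv hp) hip.symm i
  obtain ⟨k, hki, hp'k⟩ := hs.exists_leaf_ne hG.forkFree (hOv hp') hip'.symm i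
  have hjq : G.Adj (s j) q := (adj_or_adj_leaf hji hp hq hpq hpj hip.symm).resolve_right hiq
  have hkq : G.Adj q (s k) :=
    (hs.adj_or_adj hG.forkFree (hOv hq) hjq.symm hki).resolve_right fun h => hiq h.symm
  exact hqp'_not (adj_of_leaf hq hp' hqp' hkq.symm hp'k.symm)

lemma leaf_mem_commonNbrs (hG : Uncluttered G) (hP : IsPrime G) {s : Fin 3 → V}
    (hO : IsOddHole G (Gᶜ.neighborSet v) O) (hs : IsClawAt G v s) (i : Fin 3) :
    s i ∈ commonNbrs G O := by
  have hv : v ∈ commonNbrs Gᶜ (Gᶜ.neighborSet v) := fun _ hx => hx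
  have hleaf := hO.mem_commonNbrs_or_anticomplete_leaf hG hs hv
  obtain ⟨j, hj⟩ : ∃ j, s j ∈ commonNbrs G O := by
    by_contra! hn
    have hanti (j : Fin 3) {x : V} (hx : x ∈ O) : ¬ G.Adj x (s j) := fun h =>
      (hleaf j).resolve_left (hn j) x hx h.symm
    obtain ⟨w, hvw, ⟨p, hp, hwp⟩, q, hq, hwq⟩ := hO.exists_mixed_of_isPrime hP
    refine hwq (of_preconnected_induce hO.preconnected (fun d hd e he hde hwd => ?_) hp hq hwp)
    exact hs.adj_of_adj hG.forkFree hde (hO.subset hd).2 (fun j => hanti j hd)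
      (fun j => hanti j he) (Or.inl hvw.symm) hwd
  exact (hleaf i).resolve_right fun hi => hs.not_adj i j <|
    hO.adj_of_anticomplete_of_mem_commonNbrs hG.forkFree hv (hs.adj j) (hs.adj i) hj hi

lemma adj_of_compl_adj_of_mem_commonNbrs (hG : Uncluttered G)
    (hO : IsOddHole G (Gᶜ.neighborSet v) O) {u x y : V} (hvy : G.Adj v y)
    (hx : x ∈ commonNbrs G O) (hy : y ∈ commonNbrs G O) (hxy : Gᶜ.Adj x y)
    (hu : ¬ (G.Adj v u ∧ u ∈ commonNbrs G O)) (hux : G.Adj u x) : G.Adj u y := by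
  have hv : v ∈ commonNbrs Gᶜ (Gᶜ.neighborSet v) := fun _ hx => hx
  by_cases hvu : G.Adj v u
  · obtain ⟨q, hq, huq⟩ : ∃ q ∈ O, ¬ G.Adj u q := by
      simpa [commonNbrs] using fun h => hu ⟨hvu, h⟩
    by_cases hp : ∃ p ∈ O, G.Adj u p
    · obtain ⟨p, hp, hup⟩ := hp
      exact hO.adj_of_mixed_of_mem_commonNbrs hG hv hvu hy hp hq hup huq
    · push Not at hp
      exact hO.adj_of_anticomplete_of_mem_commonNbrs hG.forkFree hv hvy hvu hy hp
  by_cases huv : u = v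
  · exact huv ▸ hvy
  by_cases huO : u ∈ O
  · exact (hy u huO).symm
  have hanti {z : V} (hz : z ∈ O) : ¬ G.Adj u z := fun h =>
    huO (hO.mem_of_adj hz ⟨Ne.symm huv, hvu⟩ h.symm)
  obtain ⟨p, hp⟩ := hO.nonempty
  obtain ⟨p', hp', -, hpp'⟩ := hO.exists_adj_ne hp p
  exact hG.compl.forkFree.adj_of_diamond hpp' (hx p hp) (hx p' hp') (hy p hp) (hy p' hp') hxy.2
    hux (hanti hp) (hanti hp')

end IsOddHole

lemma IsClawAt.isBipartite_induce_compl_neighborSet [Finite V] (hG : Uncluttered G)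
    (hP : IsPrime G) {v : V} {s : Fin 3 → V} (hs : IsClawAt G v s) :
    (G.induce (Gᶜ.neighborSet v)).IsBipartite := by
  -- The leaves are complete to any odd hole `O` in the non-neighbourhood of its centre. They lie
  -- in one component of the complement of `{k | G.Adj v k ∧ k ∈ commonNbrs G O}`, and that
  -- component is a module.
  by_contra hbip
  obtain ⟨O, hO⟩ := exists_isOddHole hG.forkFree
    (cliqueFree_induce_compl_neighborSet fun t ht => hs.false_of_compl hG hP ht) hbip
  have hleaf (i : Fin 3) : s i ∈ {k | G.Adj v k ∧ k ∈ commonNbrs G O} :=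
    ⟨hs.adj i, hO.leaf_mem_commonNbrs hG hP hs i⟩
  obtain ⟨A, hAK, h0A, hconn, hclosed⟩ := exists_preconnected_component Gᶜ (hleaf 0)
  have hA : IsModule G A := by
    refine .of_compl (.of_preconnected hconn fun u hu x hx y hy hxy hux => ?_)
    have huK : ¬ (G.Adj v u ∧ u ∈ commonNbrs G O) := fun h => hu (hclosed x hx u h hux.symm)
    refine ⟨fun h => hu (h ▸ hy), fun huy => hux.2 ?_⟩
    exact hO.adj_of_compl_adj_of_mem_commonNbrs hG (hAK hx).1 (hAK hy).2 (hAK hx).2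
      hxy.symm huK huy
  have hne : A ≠ Set.univ := fun h => G.irrefl (hAK (h.ge (Set.mem_univ v))).1
  have h01 : Gᶜ.Adj (s 0) (s 1) := hs.pairwise (by decide)
  exact h01.ne (hP A hA hne h0A (hclosed _ h0A _ (hleaf 1) h01))

lemma exists_isClique_ncard_eq (G : SimpleGraph V) (X : Set V) :
    ∃ s ⊆ X, G.IsClique s ∧ s.ncard = (G.induce X).cliqueNum := by
  obtain ⟨t, ht⟩ := (G.induce X).exists_isNClique_cliqueNum
  refine ⟨Subtype.val '' (t : Set X), Subtype.coe_image_subset X t, ?_, ?_⟩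
  · exact isClique_induce_iff.1 ht.isClique
  · rw [Set.ncard_image_of_injective _ Subtype.val_injective, Set.ncard_coe_finset, ht.card_eq]

lemma ncard_le_cliqueNum [Finite V] {s : Set V} (hs : G.IsClique s) : s.ncard ≤ G.cliqueNum := by
  rw [Set.ncard_eq_toFinset_card s]
  exact IsClique.card_le_cliqueNum (tc := by simpa using hs)

lemma ncard_lt_cliqueNum [Finite V] {s : Set V} {v : V} (hs : G.IsClique s)
    (hsv : s ⊆ G.neighborSet v) : s.ncard < G.cliqueNum :=
  calc
    s.ncard < (insert v s).ncard := by
      rw [Set.ncard_insert_of_notMem fun h => G.irrefl (hsv h)]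
      exact Nat.lt_succ_self _
    _ ≤ G.cliqueNum := ncard_le_cliqueNum (hs.insert fun x hx _ => hsv hx)

lemma cliqueNum_induce_neighborSet_lt [Finite V] (v : V) :
    (G.induce (G.neighborSet v)).cliqueNum < G.cliqueNum := by
  obtain ⟨s, hsv, hs, hcard⟩ := exists_isClique_ncard_eq G (G.neighborSet v)
  exact hcard ▸ ncard_lt_cliqueNum hs hsv

lemma cliqueNum_induce_add_le [Finite V] {X Y : Set V} (h : ∀ x ∈ X, ∀ y ∈ Y, G.Adj x y) :
    (G.induce X).cliqueNum + (G.induce Y).cliqueNum ≤ G.cliqueNum := by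
  obtain ⟨s, hsX, hs, hs_card⟩ := exists_isClique_ncard_eq G X
  obtain ⟨t, htY, ht, ht_card⟩ := exists_isClique_ncard_eq G Y
  have hst : Disjoint s t :=
    Set.disjoint_left.2 fun x hx hx' => G.irrefl (h x (hsX hx) x (htY hx'))
  rw [← hs_card, ← ht_card, ← Set.ncard_union_eq hst]
  refine ncard_le_cliqueNum ?_
  rintro x (hx | hx) y (hy | hy) hxy
  exacts [hs hx hy hxy, h x (hsX hx) y (htY hy), (h y (hsX hy) x (htY hx)).symm, ht hx hy hxy]

/-- A counterexample to `χ ≤ 2 ω` all of whose proper induced subgraphs satisfy `χ ≤ 2 ω`. -/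
structure IsMinCounterexample (G : SimpleGraph V) : Prop where
  not_colorable : ¬ G.Colorable (2 * G.cliqueNum)
  induce_colorable : ∀ s : Set V, s ≠ Set.univ →
    (G.induce s).Colorable (2 * (G.induce s).cliqueNum)

namespace IsMinCounterexample

variable [Finite V]

lemma isVertexCritical (hG : IsMinCounterexample G) : IsVertexCritical G (2 * G.cliqueNum) where
  not_colorable := hG.not_colorable
  induce_colorable s hs := (hG.induce_colorable s hs).mono (by grw [G.cliqueNum_induce_le s])

lemma preconnected_compl (hG : IsMinCounterexample G) : Gᶜ.Preconnected := by
  intro u v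
  by_contra huv
  let X : Set V := {w | Gᶜ.Reachable u w}
  have hX := hG.induce_colorable X fun h => huv (h.ge (Set.mem_univ v))
  have hXc := hG.induce_colorable Xᶜ fun h => h.ge (Set.mem_univ u) (Reachable.refl u)
  have hcomplete : ∀ x ∈ X, ∀ y ∈ Xᶜ, G.Adj x y := by
    intro x hx y hy
    by_contra hxy
    have hne : x ≠ y := fun h => hy (h ▸ hx)
    exact hy (Reachable.trans hx (Adj.reachable ⟨hne, hxy⟩))
  have hle := cliqueNum_induce_add_le hcomplete
  exact hG.not_colorable ((colorable_add hX hXc).mono (by lia))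

lemma not_isBipartite_compl_induce_neighborSet (hG : IsMinCounterexample G) (v : V) :
    ¬ (Gᶜ.induce (G.neighborSet v)).IsBipartite := by
  rintro ⟨C⟩
  let s (i : Fin 2) : Set V := {x | ∃ hx : G.Adj v x, C ⟨x, hx⟩ = i}
  have hs (i : Fin 2) : (s i).ncard < G.cliqueNum := by
    refine ncard_lt_cliqueNum (v := v) ?_ fun x hx => hx.1
    rintro x ⟨hx, hxi⟩ y ⟨hy, hyi⟩ hxy
    by_contra hn
    exact C.valid (v := ⟨x, hx⟩) (w := ⟨y, hy⟩) ⟨hxy, hn⟩ (hxi.trans hyi.symm)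
  have hcover : G.neighborSet v ⊆ s 0 ∪ s 1 := by
    intro x hx
    have hC : ∀ i : Fin 2, i = 0 ∨ i = 1 := by decide
    exact (hC (C ⟨x, hx⟩)).imp (⟨hx, ·⟩) (⟨hx, ·⟩)
  have hlt : (G.neighborSet v).ncard < 2 * G.cliqueNum :=
    calc
      _ ≤ (s 0 ∪ s 1).ncard := Set.ncard_le_ncard hcover
      _ ≤ (s 0).ncard + (s 1).ncard := Set.ncard_union_le _ _
      _ < 2 * G.cliqueNum := by linarith [hs 0, hs 1]
  have hle := hG.isVertexCritical.le_encard_neighborSet v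
  rw [← (Set.toFinite (G.neighborSet v)).cast_ncard_eq, Nat.cast_le] at hle
  exact hlt.not_ge hle

lemma exists_adj_adj_compl_adj (hG : IsMinCounterexample G) (v : V) :
    ∃ k l, G.Adj v k ∧ G.Adj v l ∧ Gᶜ.Adj k l := by
  by_contra! hclique
  exact hG.not_isBipartite_compl_induce_neighborSet v
    ⟨.mk (fun _ => 0) fun {k l} hkl => (hclique k l k.2 l.2 hkl).elim⟩

lemma not_isBipartite_induce_compl_neighborSet (hG : IsMinCounterexample G) (v : V) :
    ¬ (G.induce (Gᶜ.neighborSet v)).IsBipartite := by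
  intro hbip
  have hN := hG.induce_colorable (G.neighborSet v) fun h => G.irrefl (h.ge (Set.mem_univ v))
  have hNc : (G.induce (G.neighborSet v)ᶜ).Colorable 2 := by
    let v' : ↑(G.neighborSet v)ᶜ := ⟨v, G.irrefl⟩
    let φ : (G.induce (G.neighborSet v)ᶜ).induce {v'}ᶜ →g G.induce (Gᶜ.neighborSet v) :=
      ⟨fun x => ⟨x, fun h => x.2 (Subtype.ext h.symm), x.1.2⟩, id⟩
    obtain ⟨C⟩ := hbip.of_hom φ
    exact nonempty_coloring_of_forall_ne C (a := 0) fun u hu => absurd hu u.1.2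
  have hlt := cliqueNum_induce_neighborSet_lt (G := G) v
  exact hG.not_colorable ((colorable_add hN hNc).mono (by lia))

end IsMinCounterexample

/-- A proper module that contains both an edge and a non-edge. -/
structure IsMixedModule (G : SimpleGraph V) (X : Set V) : Prop where
  isModule : IsModule G X
  ne_univ : X ≠ Set.univ
  exists_adj : ∃ x ∈ X, ∃ y ∈ X, G.Adj x y
  exists_compl_adj : ∃ x ∈ X, ∃ y ∈ X, Gᶜ.Adj x y

namespace IsMixedModule

variable {X : Set V}

lemma compl (hX : IsMixedModule G X) : IsMixedModule Gᶜ X where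
  isModule := hX.isModule.compl
  ne_univ := hX.ne_univ
  exists_adj := hX.exists_compl_adj
  exists_compl_adj := by simpa using hX.exists_adj

lemma of_subset (hX : IsMixedModule G X) {Y : Set V} (hXY : X ⊆ Y) (hY : IsModule G Y)
    (hne : Y ≠ Set.univ) : IsMixedModule G Y := by
  obtain ⟨x, hx, y, hy, hxy⟩ := hX.exists_adj
  obtain ⟨z, hz, w, hw, hzw⟩ := hX.exists_compl_adj
  exact ⟨hY, hne, ⟨x, hXY hx, y, hXY hy, hxy⟩, ⟨z, hXY hz, w, hXY hw, hzw⟩⟩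

lemma maximal_compl (hX : Maximal (IsMixedModule G) X) : Maximal (IsMixedModule Gᶜ) X :=
  ⟨hX.1.compl, fun _ hY hXY => hX.2 (by simpa using hY.compl) hXY⟩

lemma adj_of_adj (hG : ForkFree G) (hX : IsMixedModule G X) {n k l : V} (hn : n ∈ commonNbrs G X)
    (hk : k ∈ commonNbrs Gᶜ X) (hl : l ∈ commonNbrs Gᶜ X) (hkl : G.Adj k l) (hnk : G.Adj n k) :
    G.Adj n l := by
  obtain ⟨e, he, f, hf, hef⟩ := hX.exists_compl_adj
  exact adj_of_mem_commonNbrs hG he hf hef hn hk hl hkl hnk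

lemma adj_iff_of_compl_adj (hG : ForkFree Gᶜ) (hX : IsMixedModule G X) {n k l : V}
    (hn : n ∈ commonNbrs Gᶜ X) (hk : k ∈ commonNbrs G X) (hl : l ∈ commonNbrs G X)
    (hkl : Gᶜ.Adj k l) : G.Adj n k ↔ G.Adj n l := by
  obtain ⟨e, he, f, hf, hef⟩ := hX.exists_adj
  exact adj_iff_of_mem_commonNbrs_compl hG he hf hef hn hk hl hkl

lemma exists_adj_commonNbr (hG : ForkFree G) (hconn : G.Preconnected) (hX : IsMixedModule G X)
    {d : V} (hd : d ∈ commonNbrs Gᶜ X) : ∃ n ∈ commonNbrs G X, G.Adj n d := by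
  by_contra! hn
  let Z : Set V := {z | z ∈ commonNbrs Gᶜ X ∧ ∀ n ∈ commonNbrs G X, ¬ G.Adj n z}
  have hZ : Z = Set.univ := by
    refine eq_univ_of_preconnected hconn ⟨d, hd, hn⟩ ?_
    rintro x ⟨hx, hxN⟩ y hxy
    have hyX : y ∉ X := fun hy => (hx y hy).2 hxy
    have hy : y ∈ commonNbrs Gᶜ X :=
      (hX.isModule y hyX).resolve_left fun hy => hxN y hy hxy.symm
    exact ⟨hy, fun n hnX hny => hxN n hnX (hX.adj_of_adj hG hnX hy hx hxy.symm hny)⟩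
  obtain ⟨x, hx, -⟩ := hX.exists_adj
  exact notMem_of_mem_commonNbrs (hZ.ge (Set.mem_univ x)).1 hx

lemma isModule_commonNbrs_commonNbrs (hG : Uncluttered G) (hX : IsMixedModule G X) {d₁ d₂ : V}
    (h₁ : d₁ ∈ commonNbrs Gᶜ X) (h₂ : d₂ ∈ commonNbrs Gᶜ X) (hd : Gᶜ.Adj d₁ d₂)
    (hsame : ∀ n ∈ commonNbrs G X, (G.Adj n d₁ ↔ G.Adj n d₂)) :
    IsModule G (commonNbrs G (commonNbrs G (insert d₁ X))) := by
  set R := commonNbrs G (insert d₁ X)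
  have hRN {r : V} (hr : r ∈ R) : r ∈ commonNbrs G X := fun x hx => hr x (Or.inr hx)
  have hRd {r : V} (hr : r ∈ R) : G.Adj r d₁ := hr d₁ (Or.inl rfl)
  have hNR {y : V} (hy : y ∈ commonNbrs G X) (hyd : G.Adj y d₁) : y ∈ R :=
    Set.forall_mem_insert.2 ⟨hyd, hy⟩
  have hXY : X ⊆ commonNbrs G R := fun x hx r hr => (hRN hr x hx).symm
  intro v hv
  by_cases hvR : v ∈ R
  · exact Or.inl fun y hy => (hy v hvR).symm
  have hvM : v ∈ commonNbrs Gᶜ X := by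
    refine (hX.isModule v fun h => hv (hXY h)).resolve_left fun hvN => hv fun r hr => ?_
    by_contra hvr
    have hne : v ≠ r := fun h => hvR (h ▸ hr)
    exact hvR (hNR hvN ((hX.adj_iff_of_compl_adj hG.compl.forkFree h₁ hvN (hRN hr)
      ⟨hne, hvr⟩).2 (hRd hr).symm).symm)
  obtain ⟨n, hn, hvn⟩ : ∃ n ∈ R, ¬ G.Adj v n := by simpa [commonNbrs] using hv
  have anticomplete_of_adj {d : V} (hd : d ∈ commonNbrs Gᶜ X) (hnd : G.Adj n d) : ¬ G.Adj v d :=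
    fun h => hvn (hX.adj_of_adj hG.forkFree (hRN hn) hd hvM h.symm hnd).symm
  refine Or.inr fun y hy => ⟨fun h => hv (h ▸ hy), fun hvy => ?_⟩
  have hyX : y ∉ X := fun h => (hvM y h).2 hvy
  rcases hX.isModule y hyX with hyN | hyM
  · have hyd₁ : ¬ G.Adj y d₁ := fun h => G.irrefl (hy y (hNR hyN h))
    have hyd₂ : ¬ G.Adj y d₂ := fun h => hyd₁ ((hsame y hyN).2 h)
    have hnd₂ : G.Adj n d₂ := (hsame n (hRN hn)).1 (hRd hn)
    rcases hG.forkFree.adj_or_adj hd (hRd hn) hnd₂ (hy n hn).symm hvy.symm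
      (fun h => hyd₁ h.symm) (fun h => hyd₂ h.symm) hvn with h | h
    exacts [anticomplete_of_adj h₁ (hRd hn) h, anticomplete_of_adj h₂ hnd₂ h]
  · exact anticomplete_of_adj hyM (hy n hn).symm hvy

lemma exists_distinguishing_nbr (hG : Uncluttered G) (hconn : G.Preconnected)
    (hX : Maximal (IsMixedModule G) X) {d₁ d₂ : V} (h₁ : d₁ ∈ commonNbrs Gᶜ X)
    (h₂ : d₂ ∈ commonNbrs Gᶜ X) (hd : Gᶜ.Adj d₁ d₂) :
    ∃ n ∈ commonNbrs G X, ¬ (G.Adj n d₁ ↔ G.Adj n d₂) := by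
  -- Otherwise the double common neighbourhood of `insert d₁ X` is a mixed module properly
  -- containing `X`.
  by_contra! hsame
  obtain ⟨n, hn, hnd⟩ := hX.1.exists_adj_commonNbr hG.forkFree hconn h₁
  set R := commonNbrs G (insert d₁ X)
  have hnR : n ∈ R := Set.forall_mem_insert.2 ⟨hnd, hn⟩
  have hXY : X ⊆ commonNbrs G R := fun x hx r hr => (hr x (Or.inr hx)).symm
  have hY : IsMixedModule G (commonNbrs G R) :=
    hX.1.of_subset hXY (hX.1.isModule_commonNbrs_commonNbrs hG h₁ h₂ hd hsame)
      fun h => notMem_of_mem_commonNbrs (h.ge (Set.mem_univ n)) hnR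
  exact notMem_of_mem_commonNbrs h₁ (hX.2 hY hXY fun r hr => (hr d₁ (Or.inl rfl)).symm)

end IsMixedModule

namespace IsMinCounterexample

variable [Finite V]

lemma isClique_commonNbrs (hmin : IsMinCounterexample G) (hG : Uncluttered G) {X : Set V}
    (hX : Maximal (IsMixedModule G) X) : G.IsClique (commonNbrs G X) := by
  intro k hk l hl hkl
  by_contra hn
  obtain ⟨z, hkz, hlz⟩ := hmin.isVertexCritical.exists_adj_not_adj ⟨hkl, hn⟩
  have adj_iff {n : V} (hn' : n ∈ commonNbrs Gᶜ X) : G.Adj n k ↔ G.Adj n l :=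
    hX.1.adj_iff_of_compl_adj hG.compl.forkFree hn' hk hl ⟨hkl, hn⟩
  have hzX : z ∉ X := fun hz => hlz (hl z hz)
  rcases hX.1.isModule z hzX with hz | hz
  · obtain ⟨n, hnX, hnkz⟩ := IsMixedModule.exists_distinguishing_nbr hG.compl
      hmin.preconnected_compl (IsMixedModule.maximal_compl hX) (by simpa using hk)
      (by simpa using hz) (by simpa using hkz)
    have hlz' : l ≠ z := by rintro rfl; exact hn hkz
    obtain ⟨x, hx, -⟩ := hX.1.exists_adj
    have hne {y : V} (hy : y ∈ commonNbrs G X) : n ≠ y := by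
      rintro rfl
      exact (hnX x hx).2 (hy x hx)
    have hnk_iff : G.Adj n k ↔ G.Adj n z := (adj_iff hnX).trans
      (hX.1.adj_iff_of_compl_adj hG.compl.forkFree hnX hl hz ⟨hlz', hlz⟩)
    exact hnkz (by simp [hne hk, hne hz, hnk_iff])
  · exact hlz ((adj_iff hz).1 hkz.symm).symm

lemma not_isMixedModule (hmin : IsMinCounterexample G) (hG : Uncluttered G) (X : Set V) :
    ¬ IsMixedModule G X := by
  intro hX₀
  obtain ⟨X, -, hX⟩ := exists_maximal_ge_of_wellFoundedGT (IsMixedModule G) X hX₀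
  obtain ⟨b, hb, -⟩ := hX.1.exists_adj
  obtain ⟨d, hd⟩ : ∃ d, d ∈ commonNbrs Gᶜ X := by
    by_contra! hM
    refine hX.1.ne_univ (eq_univ_of_preconnected hmin.preconnected_compl ⟨b, hb⟩ ?_)
    intro x hx y hxy
    by_contra hy
    exact hxy.2 ((hX.1.isModule y hy).resolve_right (hM y) x hx).symm
  obtain ⟨k, l, hdk, hdl, hkl⟩ := hmin.exists_adj_adj_compl_adj d
  have notMem_of_adj {z : V} (hdz : G.Adj d z) : z ∉ X := fun hz => (hd z hz).2 hdz
  rcases hX.1.isModule k (notMem_of_adj hdk) with hk | hk <;>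
    rcases hX.1.isModule l (notMem_of_adj hdl) with hl | hl
  · exact hkl.2 (hmin.isClique_commonNbrs hG hX hk hl hkl.1)
  · exact hkl.2 (hX.1.adj_of_adj hG.forkFree hk hd hl hdl hdk.symm)
  · exact hkl.2 (hX.1.adj_of_adj hG.forkFree hl hd hk hdk hdl.symm).symm
  · obtain ⟨n, hn, hnkl⟩ := IsMixedModule.exists_distinguishing_nbr hG
      hmin.isVertexCritical.preconnected hX hk hl hkl
    have adj_iff {z : V} (hz : z ∈ commonNbrs Gᶜ X) (hdz : G.Adj d z) : G.Adj n z ↔ G.Adj n d :=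
      ⟨hX.1.adj_of_adj hG.forkFree hn hz hd hdz.symm, hX.1.adj_of_adj hG.forkFree hn hd hz hdz⟩
    exact hnkl ((adj_iff hk hdk).trans (adj_iff hl hdl).symm)

lemma isClique_of_isModule (hmin : IsMinCounterexample G) (hG : Uncluttered G) {X : Set V}
    (hX : IsModule G X) (hne : X ≠ Set.univ) : G.IsClique X := by
  intro x hx y hy hxy
  by_contra hn
  obtain ⟨z, hxz, hyz⟩ := hmin.isVertexCritical.exists_adj_not_adj ⟨hxy, hn⟩
  by_cases hz : z ∈ X
  · exact hmin.not_isMixedModule hG X ⟨hX, hne, ⟨x, hx, z, hz, hxz⟩, ⟨x, hx, y, hy, hxy, hn⟩⟩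
  · exact hyz (hX.mem_commonNbrs hz hx hxz.symm y hy).symm

lemma isPrime (hmin : IsMinCounterexample G) (hG : Uncluttered G) : IsPrime G := by
  intro X hX hne a ha b hb
  by_contra hab
  -- The component of `k` in the complement of `commonNbrs G X` is a module containing the
  -- non-adjacent vertices `k` and `l`, whereas all proper modules are cliques.
  have hXclique := hmin.isClique_of_isModule hG hX hne
  obtain ⟨k, l, hak, hal, hkl⟩ := hmin.exists_adj_adj_compl_adj a
  have mem_commonNbrs {k l : V} (hak : G.Adj a k) (hal : G.Adj a l) (hkl : Gᶜ.Adj k l) :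
      k ∈ commonNbrs G X := by
    refine hX.mem_commonNbrs (fun hk => hkl.2 ?_) ha hak.symm
    by_cases hl : l ∈ X
    · exact hXclique hk hl hkl.1
    · exact (hX.mem_commonNbrs hl ha hal.symm k hk).symm
  obtain ⟨A, hAN, hkA, hconn, hclosed⟩ :=
    exists_preconnected_component Gᶜ (mem_commonNbrs hak hal hkl)
  have hA : IsModule G A := by
    refine .of_compl (.of_preconnected hconn fun w hw x hx y hy hxy hwx => ?_)
    refine ⟨fun h => hw (h ▸ hy), fun hwy => hwx.2 ?_⟩
    have hwX : w ∉ X := fun h => hwx.2 (hAN hx w h).symm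
    rcases hX w hwX with hwN | hwM
    · exact absurd (hclosed x hx w hwN hwx.symm) hw
    · exact (adj_iff_of_mem_commonNbrs_compl hG.compl.forkFree ha hb (hXclique ha hb hab) hwM
        (hAN hx) (hAN hy) hxy).2 hwy
  have hlA : l ∈ A := hclosed k hkA l (mem_commonNbrs hal hak hkl.symm) hkl
  have hA_ne : A ≠ Set.univ := fun h =>
    notMem_of_mem_commonNbrs (hAN (h.ge (Set.mem_univ a))) ha
  exact hkl.2 (hmin.isClique_of_isModule hG hA hA_ne hkA hlA hkl.1)

lemma not_uncluttered (hmin : IsMinCounterexample G) : ¬ Uncluttered G := by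
  intro hG
  have hP := hmin.isPrime hG
  by_cases hclaw : ∃ v s, IsClawAt G v s
  · obtain ⟨v, s, hs⟩ := hclaw
    exact hmin.not_isBipartite_induce_compl_neighborSet v
      (hs.isBipartite_induce_compl_neighborSet hG hP)
  · push Not at hclaw
    obtain ⟨v⟩ : Nonempty V := by
      by_contra! hV
      exact hmin.not_colorable (.of_isEmpty _)
    have hbip := isBipartite_induce_compl_neighborSet_of_forall_not_isClawAt hG.compl.forkFree
      hP.compl (by simpa using hclaw) v
    rw [compl_compl] at hbip
    exact hmin.not_isBipartite_compl_induce_neighborSet v hbip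

end IsMinCounterexample

lemma colorable_two_mul_cliqueNum [Finite V] (hG : Uncluttered G) :
    G.Colorable (2 * G.cliqueNum) := by
  induction hn : Nat.card V using Nat.strong_induction_on generalizing V with
  | _ n ih =>
    by_contra hcol
    refine IsMinCounterexample.not_uncluttered ⟨hcol, fun s hs => ?_⟩ hG
    have hcard : Nat.card s < n := by
      rw [← hn, ← Set.ncard_univ V]
      exact Set.ncard_lt_ncard (Set.ssubset_univ_iff.2 hs)
    exact ih _ hcard (hG.induce s) rfl

end Uncluttered

theorem theorem1p1 {V : Type*} [Finite V] (G : SimpleGraph V) (hG : Uncluttered G) :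
    G.chromaticNumber ≤ 2 * (G.cliqueNum : ℕ∞) := by
  exact_mod_cast hG.colorable_two_mul_cliqueNum.chromaticNumber_le
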